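/- Let $\mathcal C=(\mathcal C,\mathbb E,\mathfrak s)$ be an extriangulated category (in the sense of Nakaoka and Palu) with enough projectives and enough injectives. "Subcategory" means a full additive subcategory closed under isomorphisms and direct summands. A conflation $A\to B\to C$ is a sequence realizing some $\delta\in\mathbb E(C,A)$. Higher extensions are $\mathbb E^{i+1}(X,Y)=\mathbb E(\Omega^iX,Y)$ for $i\ge 0$, where $\Omega X$ denotes a syzygy of $X$, that is, the first term of a conflation $\Omega X\to P\to X$ with $P$ projective. For a subcategory $\mathcal Y$ and $n\ge 0$, let $\widehat{\mathcal Y_n}$ be the class of objects $M$ admitting an $\mathbb E$-triangle sequence $Y_n\to\cdots\to Y_0\to M$ with all $Y_i\in\mathcal Y$; thus $\widehat{\mathcal Y_0}=\mathcal Y$, and $M\in\widehat{\mathcal Y_{n+1}}$ iff there is a conflation $K\to Y_0\to M$ with $Y_0\in\mathcal Y$ and $K\in\widehat{\mathcal Y_n}$. A pair $(\mathcal X,\mathcal W)$ of subcategories is a strong left Frobenius pair if - $\mathcal X$ is closed under extensions and under cocones of deflations (for a conflation $A\to B\to C$: $A,C\in\mathcal X$ implies $B\in\mathcal X$, and $B,C\in\mathcal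 X$ implies $A\in\mathcal X$); - $\mathcal W\subseteq\mathcal X$, and every $X\in\mathcal X$ has conflations $X\to W\to X'$ and $X''\to W'\to X$ with $W,W'\in\mathcal W$ and $X',X''\in\mathcal X$; - $\mathbb E^i(X,W)=0=\mathbb E^i(W,X)$ for all $i\ge1$, $X\in\mathcal X$, $W\in\mathcal W$. A cotorsion pair on $\mathcal C$ is a pair $(\mathcal U,\mathcal V)$ of subcategories with $\mathbb E(\mathcal U,\mathcal V)=0$ such that every object $M$ has conflations $V\to U\to M$ and $M\to V'\to U'$ with $U,U'\in\mathcal U$ and $V,V'\in\mathcal V$. A Hovey twin cotorsion pair, also called an admissible model structure, is a pair $((\mathcal S,\mathcal T),(\mathcal U,\mathcal V))$ of cotorsion pairs on $\mathcal C$ with $\mathbb E(\mathcal S,\mathcal V)=0$ and $\mathrm{Cone}(\mathcal V,\mathcal S)=\mathrm{CoCone}(\mathcal V,\mathcal S)$, where $\mathrm{Cone}(\mathcal V,\mathcal S)$ (resp. $\mathrm{CoCone}(\mathcal V,\mathcal S)$) consists of the objects $M$ with a conflation $V\to S\to M$ (resp. $M\to V\to S$), $V\in\mathcal V$, $S\in\mathcal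 S$. **Theorem.** Let $(\mathcal X,\mathcal W)$ be a strong left Frobenius pair in $\mathcal C$ and let $n\ge 0$ be an integer. The following are equivalent: 1. $\widehat{\mathcal X_n}=\mathcal C$ (every object has $\mathcal X$-resolution dimension at most $n$); 2. $((\mathcal W,\mathcal C),(\mathcal X,\widehat{\mathcal W_n}))$ is an admissible model structure on $\mathcal C$, that is, a Hovey twin cotorsion pair. -/

import Mathlib

open CategoryTheory CategoryTheory.Limits Opposite

universe w v u

namespace Extri

section Bifunctor

variable {C : Type u} [Category.{v} C]

/-- The group `𝔼(X, A)` of extensions of a biadditive functor `𝔼 : Cᵒᵖ × C ⥤ Ab` (curried). -/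
abbrev Extn (E : Cᵒᵖ ⥤ C ⥤ AddCommGrpCat.{w}) (X A : C) : Type w :=
  ((E.obj (op X)).obj A)

/-- `a_* δ`, for `a : A ⟶ A'` and `δ ∈ 𝔼(X, A)`. -/
def push (E : Cᵒᵖ ⥤ C ⥤ AddCommGrpCat.{w}) {X A A' : C} (a : A ⟶ A') (δ : Extn E X A) :
    Extn E X A' :=
  ((E.obj (op X)).map a).hom δ

/-- `c^* δ`, for `c : X' ⟶ X` and `δ ∈ 𝔼(X, A)`. -/
def pull (E : Cᵒᵖ ⥤ C ⥤ AddCommGrpCat.{w}) {X X' A : C} (c : X' ⟶ X) (δ : Extn E X A) :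
    Extn E X' A :=
  ((E.map c.op).app A).hom δ

/-- A sequence `A ⟶ B ⟶ X` with fixed end terms. -/
structure Seq (A X : C) where
  mid : C
  x : A ⟶ mid
  y : mid ⟶ X

/-- Two sequences `A ⟶ B ⟶ X` and `A ⟶ B' ⟶ X` are equivalent if there is an isomorphism
`B ≅ B'` compatible with the identities of `A` and `X`. -/
def Seq.Equiv {A X : C} (S S' : Seq A X) : Prop :=
  ∃ b : S.mid ≅ S'.mid, S.x ≫ b.hom = S'.x ∧ b.hom ≫ S'.y = S.y

instance seqSetoid (A X : C) : Setoid (Seq A X) where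
  r := Seq.Equiv
  iseqv :=
    { refl := fun S => ⟨Iso.refl _, by simp, by simp⟩
      symm := by
        rintro S S' ⟨b, h₁, h₂⟩
        exact ⟨b.symm, by simp [← h₁], by simp [← h₂]⟩
      trans := by
        rintro S S' S'' ⟨b, h₁, h₂⟩ ⟨b', h₁', h₂'⟩
        exact ⟨b ≪≫ b', by rw [← h₁', ← h₁]; simp, by rw [← h₂, ← h₂']; simp⟩ }

/-- The equivalence class `[A ⟶ B ⟶ X]`. -/
def seqClass {A B X : C} (x : A ⟶ B) (y : B ⟶ X) : Quotient (seqSetoid A X) :=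
  Quotient.mk _ ⟨B, x, y⟩

end Bifunctor

section Additive

variable {C : Type u} [Category.{v} C] [Preadditive C] [HasBinaryBiproducts C]

/-- The direct sum `δ ⊕ δ' ∈ 𝔼(X ⊕ X', A ⊕ A')`, the element corresponding to `(δ, 0, 0, δ')`
under the decomposition of `𝔼(X ⊕ X', A ⊕ A')` into four summands. -/
noncomputable def extSum (E : Cᵒᵖ ⥤ C ⥤ AddCommGrpCat.{w}) {X X' A A' : C}
    (δ : Extn E X A) (δ' : Extn E X' A') : Extn E (X ⊞ X') (A ⊞ A') :=
  push E biprod.inl (pull E biprod.fst δ) + push E biprod.inr (pull E biprod.snd δ')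

end Additive

/-- The structure `(𝔼, 𝔰)` of an extriangulated category in the sense of Nakaoka and Palu on an
additive category `C`. -/
structure ExtriangulatedStructure (C : Type u) [Category.{v} C] [Preadditive C]
    [HasZeroObject C] [HasBinaryBiproducts C] where
  /-- (ET1) the additive bifunctor `𝔼` -/
  E : Cᵒᵖ ⥤ C ⥤ AddCommGrpCat.{w}
  additive_left : E.Additive
  additive_right : ∀ X : Cᵒᵖ, (E.obj X).Additive
  /-- (ET2) the additive realization `𝔰` -/
  s : ∀ {X A : C}, Extn E X A → Quotient (seqSetoid A X)
  /-- A morphism of extensions lifts to a morphism of the realizing sequences. -/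
  realization : ∀ {A B X A' B' X' : C} (δ : Extn E X A) (δ' : Extn E X' A')
    (x : A ⟶ B) (y : B ⟶ X) (x' : A' ⟶ B') (y' : B' ⟶ X'),
    s δ = seqClass x y → s δ' = seqClass x' y' →
    ∀ (a : A ⟶ A') (c : X ⟶ X'), push E a δ = pull E c δ' →
      ∃ b : B ⟶ B', x ≫ b = a ≫ x' ∧ b ≫ y' = y ≫ c
  s_zero : ∀ X A : C,
    s (0 : Extn E X A) = seqClass (biprod.inl : A ⟶ A ⊞ X) (biprod.snd : A ⊞ X ⟶ X)
  s_sum : ∀ {A B X A' B' X' : C} (δ : Extn E X A) (δ' : Extn E X' A')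
    (x : A ⟶ B) (y : B ⟶ X) (x' : A' ⟶ B') (y' : B' ⟶ X'),
    s δ = seqClass x y → s δ' = seqClass x' y' →
      s (extSum E δ δ') = seqClass (biprod.map x x') (biprod.map y y')
  /-- (ET3) -/
  et3 : ∀ {A B X A' B' X' : C} (δ : Extn E X A) (δ' : Extn E X' A')
    (x : A ⟶ B) (y : B ⟶ X) (x' : A' ⟶ B') (y' : B' ⟶ X'),
    s δ = seqClass x y → s δ' = seqClass x' y' →
    ∀ (a : A ⟶ A') (b : B ⟶ B'), x ≫ b = a ≫ x' →
      ∃ c : X ⟶ X', y ≫ c = b ≫ y' ∧ push E a δ = pull E c δ'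
  /-- (ET3)ᵒᵖ -/
  et3_op : ∀ {A B X A' B' X' : C} (δ : Extn E X A) (δ' : Extn E X' A')
    (x : A ⟶ B) (y : B ⟶ X) (x' : A' ⟶ B') (y' : B' ⟶ X'),
    s δ = seqClass x y → s δ' = seqClass x' y' →
    ∀ (b : B ⟶ B') (c : X ⟶ X'), b ≫ y' = y ≫ c →
      ∃ a : A ⟶ A', x ≫ b = a ≫ x' ∧ push E a δ = pull E c δ'
  /-- (ET4) -/
  et4 : ∀ {A B D M F : C} (δ : Extn E D A) (δ' : Extn E F B)
    (f : A ⟶ B) (f' : B ⟶ D) (g : B ⟶ M) (g' : M ⟶ F),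
    s δ = seqClass f f' → s δ' = seqClass g g' →
      ∃ (N : C) (h' : M ⟶ N) (d : D ⟶ N) (e : N ⟶ F) (δ'' : Extn E N A),
        g ≫ h' = f' ≫ d ∧ h' ≫ e = g' ∧
        s δ'' = seqClass (f ≫ g) h' ∧
        s (push E f' δ') = seqClass d e ∧
        pull E d δ'' = δ ∧
        push E f δ'' = pull E e δ'
  /-- (ET4)ᵒᵖ -/
  et4_op : ∀ {D A B F M : C} (δ : Extn E B D) (δ' : Extn E M F)
    (f' : D ⟶ A) (f : A ⟶ B) (g' : F ⟶ B) (g : B ⟶ M),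
    s δ = seqClass f' f → s δ' = seqClass g' g →
      ∃ (N : C) (d : D ⟶ N) (e : N ⟶ F) (h' : N ⟶ A) (δ'' : Extn E M N),
        d ≫ h' = f' ∧ h' ≫ f = e ≫ g' ∧
        s δ'' = seqClass h' (f ≫ g) ∧
        s (pull E g' δ) = seqClass d e ∧
        push E e δ'' = δ' ∧
        push E d δ = pull E g δ''

/-- A subcategory: a full additive subcategory closed under isomorphisms and direct summands
(and not merely under retracts, as idempotents need not split). -/
structure IsSubcategory {C : Type u} [Category.{v} C] [Preadditive C]
    [HasBinaryBiproducts C] (P : ObjectProperty C) : Prop where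
  zero : ∀ Z : C, IsZero Z → P Z
  iso : ∀ {A B : C}, (A ≅ B) → P A → P B
  sum : ∀ {A B : C}, P A → P B → P (A ⊞ B)
  summand : ∀ {A B : C}, P (A ⊞ B) → P A

namespace ExtriangulatedStructure

variable {C : Type u} [Category.{v} C] [Preadditive C] [HasZeroObject C] [HasBinaryBiproducts C]
variable (T : ExtriangulatedStructure.{w} C)

/-- `A ⟶ B ⟶ X` is a conflation, i.e. it realizes some extension. -/
def Conflation {A B X : C} (x : A ⟶ B) (y : B ⟶ X) : Prop :=
  ∃ δ : Extn T.E X A, T.s δ = seqClass x y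

def IsProjective (P : C) : Prop :=
  ∀ {A B X : C} (x : A ⟶ B) (y : B ⟶ X), T.Conflation x y →
    ∀ c : P ⟶ X, ∃ b : P ⟶ B, b ≫ y = c

def IsInjective (I : C) : Prop :=
  ∀ {A B X : C} (x : A ⟶ B) (y : B ⟶ X), T.Conflation x y →
    ∀ a : A ⟶ I, ∃ b : B ⟶ I, x ≫ b = a

def EnoughProjectives : Prop :=
  ∀ X : C, ∃ (A P : C) (x : A ⟶ P) (y : P ⟶ X), T.IsProjective P ∧ T.Conflation x y

def EnoughInjectives : Prop :=
  ∀ A : C, ∃ (I X : C) (x : A ⟶ I) (y : I ⟶ X), T.IsInjective I ∧ T.Conflation x y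

/-- A (chosen) syzygy `ΩX`, the first term of a conflation `ΩX ⟶ P ⟶ X` with `P` projective. -/
noncomputable def syzygy (hP : T.EnoughProjectives) (X : C) : C :=
  (hP X).choose

/-- The iterated syzygy `Ωⁱ X`. -/
noncomputable def iterSyzygy (hP : T.EnoughProjectives) : ℕ → C → C
  | 0, X => X
  | i + 1, X => T.syzygy hP (iterSyzygy hP i X)

/-- The higher extension group `𝔼ⁱ⁺¹(X, Y) = 𝔼(Ωⁱ X, Y)`; up to isomorphism it does not depend on
the choice of the syzygies. -/
abbrev ExtSucc (hP : T.EnoughProjectives) (i : ℕ) (X Y : C) : Type w :=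
  Extn T.E (T.iterSyzygy hP i X) Y

/-- `𝒳^⊥`: the objects `Y` with `𝔼ⁱ(X, Y) = 0` for all `i ≥ 1` and all `X ∈ 𝒳`. -/
def rightPerp (hP : T.EnoughProjectives) (𝒳 : ObjectProperty C) : ObjectProperty C :=
  fun Y => ∀ (i : ℕ) (X : C), 𝒳 X → ∀ δ : T.ExtSucc hP i X Y, δ = 0

/-- `^⊥𝒳`: the objects `Y` with `𝔼ⁱ(Y, X) = 0` for all `i ≥ 1` and all `X ∈ 𝒳`. -/
def leftPerp (hP : T.EnoughProjectives) (𝒳 : ObjectProperty C) : ObjectProperty C :=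
  fun Y => ∀ (i : ℕ) (X : C), 𝒳 X → ∀ δ : T.ExtSucc hP i Y X, δ = 0

/-- The class of objects `M` with a resolution `Xₙ ⟶ ⋯ ⟶ X₀ ⟶ M` by objects of `𝒳`, i.e. there
are conflations `Kᵢ₊₁ ⟶ Xᵢ ⟶ Kᵢ` for `0 ≤ i < n` with `K₀ = M` and `Kₙ = Xₙ`. -/
def resHat (𝒳 : ObjectProperty C) : ℕ → ObjectProperty C
  | 0 => 𝒳
  | n + 1 => fun M => ∃ (K X₀ : C) (x : K ⟶ X₀) (y : X₀ ⟶ M),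
      resHat 𝒳 n K ∧ 𝒳 X₀ ∧ T.Conflation x y

def ClosedUnderExtensions (𝒳 : ObjectProperty C) : Prop :=
  ∀ {A B X : C} (x : A ⟶ B) (y : B ⟶ X), T.Conflation x y → 𝒳 A → 𝒳 X → 𝒳 B

def ClosedUnderCoconesOfDeflations (𝒳 : ObjectProperty C) : Prop :=
  ∀ {A B X : C} (x : A ⟶ B) (y : B ⟶ X), T.Conflation x y → 𝒳 B → 𝒳 X → 𝒳 A

def IsCogenerator (𝒲 𝒳 : ObjectProperty C) : Prop :=
  𝒲 ≤ 𝒳 ∧ ∀ X : C, 𝒳 X → ∃ (W X' : C) (x : X ⟶ W) (y : W ⟶ X'),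
    𝒲 W ∧ 𝒳 X' ∧ T.Conflation x y

def IsGenerator (𝒲 𝒳 : ObjectProperty C) : Prop :=
  𝒲 ≤ 𝒳 ∧ ∀ X : C, 𝒳 X → ∃ (X' W : C) (x : X' ⟶ W) (y : W ⟶ X),
    𝒲 W ∧ 𝒳 X' ∧ T.Conflation x y

/-- Left Frobenius pair `(𝒳, 𝒲)`. -/
structure IsLeftFrobeniusPair (hP : T.EnoughProjectives) (𝒳 𝒲 : ObjectProperty C) : Prop where
  subcategory_left : IsSubcategory 𝒳
  subcategory_right : IsSubcategory 𝒲
  extensions : T.ClosedUnderExtensions 𝒳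
  cocones : T.ClosedUnderCoconesOfDeflations 𝒳
  cogenerator : T.IsCogenerator 𝒲 𝒳
  injective : 𝒲 ≤ T.rightPerp hP 𝒳

/-- Strong left Frobenius pair `(𝒳, 𝒲)`. -/
structure IsStrongLeftFrobeniusPair (hP : T.EnoughProjectives) (𝒳 𝒲 : ObjectProperty C) : Prop
    extends T.IsLeftFrobeniusPair hP 𝒳 𝒲 where
  generator : T.IsGenerator 𝒲 𝒳
  projective : 𝒲 ≤ T.leftPerp hP 𝒳

/-- `𝔼(𝒰, 𝒱) = 0`. -/
def ExtVanish (𝒰 𝒱 : ObjectProperty C) : Prop :=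
  ∀ U V : C, 𝒰 U → 𝒱 V → ∀ δ : Extn T.E U V, δ = 0

/-- `Cone(𝒳, 𝒴)`: objects `M` with a conflation `X ⟶ Y ⟶ M`, `X ∈ 𝒳`, `Y ∈ 𝒴`. -/
def Cone (𝒳 𝒴 : ObjectProperty C) : ObjectProperty C :=
  fun M => ∃ (X Y : C) (x : X ⟶ Y) (y : Y ⟶ M), 𝒳 X ∧ 𝒴 Y ∧ T.Conflation x y

/-- `CoCone(𝒳, 𝒴)`: objects `M` with a conflation `M ⟶ X ⟶ Y`, `X ∈ 𝒳`, `Y ∈ 𝒴`. -/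
def CoCone (𝒳 𝒴 : ObjectProperty C) : ObjectProperty C :=
  fun M => ∃ (X Y : C) (x : M ⟶ X) (y : X ⟶ Y), 𝒳 X ∧ 𝒴 Y ∧ T.Conflation x y

/-- Cotorsion pair `(𝒰, 𝒱)` on `C`. -/
structure IsCotorsionPair (𝒰 𝒱 : ObjectProperty C) : Prop where
  subcategory_left : IsSubcategory 𝒰
  subcategory_right : IsSubcategory 𝒱
  vanish : T.ExtVanish 𝒰 𝒱
  /-- conflations `V ⟶ U ⟶ M` -/
  cone : ∀ M : C, T.Cone 𝒱 𝒰 M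
  /-- conflations `M ⟶ V ⟶ U` -/
  cocone : ∀ M : C, T.CoCone 𝒱 𝒰 M

/-- `((𝒮, 𝒯), (𝒰, 𝒱))` is a twin cotorsion pair. -/
structure IsTwinCotorsionPair (𝒮 𝒯 𝒰 𝒱 : ObjectProperty C) : Prop where
  left : T.IsCotorsionPair 𝒮 𝒯
  right : T.IsCotorsionPair 𝒰 𝒱
  vanish : T.ExtVanish 𝒮 𝒱

/-- `((𝒮, 𝒯), (𝒰, 𝒱))` is a Hovey twin cotorsion pair, alias an admissible model structure. -/
structure IsHoveyTwinCotorsionPair (𝒮 𝒯 𝒰 𝒱 : ObjectProperty C) : Prop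
    extends T.IsTwinCotorsionPair 𝒮 𝒯 𝒰 𝒱 where
  hovey : T.Cone 𝒱 𝒮 = T.CoCone 𝒱 𝒮

end ExtriangulatedStructure

end Extri

/-! If ((𝒲, C), (𝒳, 𝒲̂ₙ)) is a Hovey pair, each M has a conflation M → V → U with V ∈ 𝒲̂ₙ ⊆ 𝒳̂ₙ and
U ∈ 𝒳; closure under cocones keeps M in 𝒳̂ₙ (`resHat_of_conflation_of_resHat`).

Conversely, let every object have 𝒳-dimension at most n. Dimension shifting turns 𝔼ⁱ(𝒲, 𝒳) = 0 into
𝔼(𝒲, C) = 0, and projectives lie in 𝒲, so (𝒲, C) is a cotorsion pair. The crux is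
`resHat_eq_extPerp`: 𝒲̂ₙ consists of all Y with 𝔼(𝒳, Y) = 0. Hence the lengths produced by
Auslander–Buchweitz approximation need no control, and both classes in the Hovey condition equal
𝒲̂ₙ. -/

namespace Extri

/-! ### Functoriality of 𝔼 and realizing sequences -/

section Functoriality

variable {C : Type u} [Category.{v} C] (E : Cᵒᵖ ⥤ C ⥤ AddCommGrpCat.{w})

theorem push_id {X A : C} (δ : Extn E X A) : push E (𝟙 A) δ = δ := by
  simp [push]

theorem pull_id {X A : C} (δ : Extn E X A) : pull E (𝟙 X) δ = δ := by
  simp [pull]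

theorem push_push {X A A' A'' : C} (a : A ⟶ A') (a' : A' ⟶ A'') (δ : Extn E X A) :
    push E a' (push E a δ) = push E (a ≫ a') δ := by
  simp [push]

theorem pull_pull {X X' X'' A : C} (c : X' ⟶ X) (c' : X'' ⟶ X') (δ : Extn E X A) :
    pull E c' (pull E c δ) = pull E (c' ≫ c) δ := by
  simp [pull]

theorem push_pull {X X' A A' : C} (a : A ⟶ A') (c : X' ⟶ X) (δ : Extn E X A) :
    push E a (pull E c δ) = pull E c (push E a δ) := by
  simp [push, pull]

theorem push_map_zero {X A A' : C} (a : A ⟶ A') : push E a (0 : Extn E X A) = 0 :=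
  map_zero _

theorem pull_map_zero {X X' A : C} (c : X' ⟶ X) : pull E c (0 : Extn E X A) = 0 :=
  map_zero _

theorem push_map_add {X A A' : C} (a : A ⟶ A') (δ δ' : Extn E X A) :
    push E a (δ + δ') = push E a δ + push E a δ' :=
  map_add _ _ _

theorem pull_map_add {X X' A : C} (c : X' ⟶ X) (δ δ' : Extn E X A) :
    pull E c (δ + δ') = pull E c δ + pull E c δ' :=
  map_add _ _ _

end Functoriality

section Sequences

variable {C : Type u} [Category.{v} C]

theorem exists_iso_of_seqClass_eq {A X B B' : C} {x : A ⟶ B} {y : B ⟶ X} {x' : A ⟶ B'}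
    {y' : B' ⟶ X} (h : seqClass x y = seqClass x' y') :
    ∃ b : B ≅ B', x ≫ b.hom = x' ∧ b.hom ≫ y' = y :=
  Quotient.exact h

theorem seqClass_eq_of_iso {A X B B' : C} {x : A ⟶ B} {y : B ⟶ X} {x' : A ⟶ B'}
    {y' : B' ⟶ X} (b : B ≅ B') (h₁ : x ≫ b.hom = x') (h₂ : b.hom ≫ y' = y) :
    seqClass x y = seqClass x' y' :=
  Quotient.sound ⟨b, h₁, h₂⟩

end Sequences

open scoped ZeroObject

namespace ExtriangulatedStructure

variable {C : Type u} [Category.{v} C] [Preadditive C] [HasZeroObject C] [HasBinaryBiproducts C]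
variable (T : ExtriangulatedStructure.{w} C)

theorem push_zero {X A A' : C} (δ : Extn T.E X A) : push T.E (0 : A ⟶ A') δ = 0 := by
  have := T.additive_right (op X)
  simp [push]

theorem push_add {X A A' : C} (a a' : A ⟶ A') (δ : Extn T.E X A) :
    push T.E (a + a') δ = push T.E a δ + push T.E a' δ := by
  have := T.additive_right (op X)
  simp [push, Functor.map_add]

theorem pull_zero {X X' A : C} (δ : Extn T.E X A) : pull T.E (0 : X' ⟶ X) δ = 0 := by
  have := T.additive_left
  simp [pull]

theorem exists_realization {X A : C} (δ : Extn T.E X A) :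
    ∃ (B : C) (x : A ⟶ B) (y : B ⟶ X), T.s δ = seqClass x y := by
  obtain ⟨S, hS⟩ := Quotient.exists_rep (T.s δ)
  exact ⟨S.mid, S.x, S.y, hS.symm⟩

/-- The split sequence with the two summands interchanged. -/
theorem s_zero_swap (X A : C) :
    T.s (0 : Extn T.E X A) = seqClass (biprod.inr : A ⟶ X ⊞ A) (biprod.fst : X ⊞ A ⟶ X) := by
  rw [T.s_zero]
  exact seqClass_eq_of_iso (biprod.braiding A X) (by ext <;> simp) (by simp)

variable {T}

/-! ### Exactness properties of a conflation -/

section Exactness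

variable {A B X : C} {δ : Extn T.E X A} {x : A ⟶ B} {y : B ⟶ X}

theorem pull_eq_zero_of_factors (hδ : T.s δ = seqClass x y) {X' : C} (g : X' ⟶ B) :
    pull T.E (g ≫ y) δ = 0 := by
  -- Mapping from a split sequence makes the pullback a pushforward of `0`, whatever `a` is.
  obtain ⟨a, -, ha⟩ := T.et3_op (0 : Extn T.E X' A) δ _ _ x y (T.s_zero _ _) hδ
    (biprod.snd ≫ g) (g ≫ y) (by simp)
  rw [← ha, push_map_zero]

theorem exists_factor_of_pull_eq_zero (hδ : T.s δ = seqClass x y) {X' : C} (f : X' ⟶ X)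
    (hf : pull T.E f δ = 0) : ∃ g : X' ⟶ B, g ≫ y = f := by
  obtain ⟨b, -, hb⟩ := T.realization (0 : Extn T.E X' A) δ _ _ x y (T.s_zero _ _) hδ (𝟙 A) f
    (by rw [push_map_zero, hf])
  exact ⟨biprod.inr ≫ b, by simp [hb]⟩

theorem exists_extension_of_push_eq_zero (hδ : T.s δ = seqClass x y) {A' : C} (f : A ⟶ A')
    (hf : push T.E f δ = 0) : ∃ g : B ⟶ A', x ≫ g = f := by
  obtain ⟨b, hb, -⟩ := T.realization δ (0 : Extn T.E X A') x y _ _ hδ (T.s_zero _ _) f (𝟙 X)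
    (by rw [pull_map_zero, hf])
  exact ⟨b ≫ biprod.fst, by simp [reassoc_of% hb]⟩

/-- The second morphism of a conflation is a weak cokernel of the first one. -/
theorem exists_desc_of_comp_eq_zero (hδ : T.s δ = seqClass x y) {Z : C} (f : B ⟶ Z)
    (hf : x ≫ f = 0) : ∃ g : X ⟶ Z, y ≫ g = f := by
  obtain ⟨c, hc, -⟩ := T.et3 δ (0 : Extn T.E Z A) x y _ _ hδ (T.s_zero _ _) 0
    (f ≫ biprod.inr) (by simp [reassoc_of% hf])
  exact ⟨c, by simp [hc]⟩

theorem exists_pull_eq_of_push_eq_zero (hδ : T.s δ = seqClass x y) {X' : C}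
    (ξ : Extn T.E X' A) (hξ : push T.E x ξ = 0) : ∃ f : X' ⟶ X, pull T.E f δ = ξ := by
  obtain ⟨B', x', y', hξ'⟩ := T.exists_realization ξ
  obtain ⟨g, hg⟩ := exists_extension_of_push_eq_zero hξ' x hξ
  obtain ⟨c, -, hc⟩ := T.et3 ξ δ x' y' x y hξ' hδ (𝟙 A) g (by simp [hg])
  exact ⟨c, by rw [← hc, push_id]⟩

theorem exists_push_eq_of_isProjective (hδ : T.s δ = seqClass x y) (hB : T.IsProjective B)
    {M : C} (ξ : Extn T.E X M) : ∃ f : A ⟶ M, push T.E f δ = ξ := by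
  obtain ⟨B', x', y', hξ⟩ := T.exists_realization ξ
  obtain ⟨b, hb⟩ := hB x' y' ⟨ξ, hξ⟩ y
  obtain ⟨a, -, ha⟩ := T.et3_op δ ξ x y x' y' hδ hξ b (𝟙 X) (by simp [hb])
  exact ⟨a, by rw [ha, pull_id]⟩

/-- An endomorphism of the middle term over the identities of the ends is `1 + ν` with
`ν ^ 2 = 0`. -/
theorem isIso_of_endomorphism (hδ : T.s δ = seqClass x y) (φ : B ⟶ B) (h₁ : x ≫ φ = x)
    (h₂ : φ ≫ y = y) : IsIso φ := by
  obtain ⟨m, hm⟩ := exists_desc_of_comp_eq_zero hδ (φ - 𝟙 B) (by simp [h₁])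
  have hsq : (φ - 𝟙 B) ≫ (φ - 𝟙 B) = 0 := by
    nth_rewrite 2 [← hm]
    rw [← Category.assoc]
    simp [h₂]
  have h : φ ≫ φ = φ + φ - 𝟙 B := by
    simp only [Preadditive.sub_comp, Preadditive.comp_sub, Category.comp_id,
      Category.id_comp] at hsq
    rw [← sub_eq_zero, ← hsq]
    abel
  refine ⟨𝟙 B + 𝟙 B - φ, ?_, ?_⟩
  · simp [h]
  · simp [h]

/-- Replacing the ends of a conflation by isomorphic objects gives a conflation. -/
theorem Conflation.of_iso_ends (h : T.Conflation x y) {A' X' : C} (a : A ≅ A') (c : X ≅ X') :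
    T.Conflation (a.inv ≫ x) (y ≫ c.hom) := by
  obtain ⟨δ, hδ⟩ := h
  obtain ⟨B', x', y', hδ'⟩ := T.exists_realization (push T.E a.hom (pull T.E c.inv δ))
  obtain ⟨b, hb₁, hb₂⟩ := T.realization δ _ x y x' y' hδ hδ' a.hom c.hom
    (by rw [← push_pull, pull_pull, c.hom_inv_id, pull_id])
  obtain ⟨b', hb'₁, hb'₂⟩ := T.realization _ δ x' y' x y hδ' hδ a.inv c.inv
    (by rw [push_push, a.hom_inv_id, push_id])
  -- The composites of the two lifts need not be identities, but being isomorphisms they give `b` a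
  -- left and a right inverse.
  have i₁ : IsIso (b ≫ b') := isIso_of_endomorphism hδ _
    (by rw [reassoc_of% hb₁, hb'₁]; simp) (by rw [Category.assoc, hb'₂, reassoc_of% hb₂]; simp)
  have i₂ : IsIso (b' ≫ b) := isIso_of_endomorphism hδ' _
    (by rw [reassoc_of% hb'₁, hb₁]; simp) (by rw [Category.assoc, hb₂, reassoc_of% hb'₂]; simp)
  have i : IsIso b := by
    have hr : b ≫ (b' ≫ inv (b ≫ b')) = 𝟙 B := by
      rw [← Category.assoc, IsIso.hom_inv_id]
    have hl : (inv (b' ≫ b) ≫ b') ≫ b = 𝟙 B' := by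
      rw [Category.assoc, IsIso.inv_hom_id]
    have heq : inv (b' ≫ b) ≫ b' = b' ≫ inv (b ≫ b') := by
      rw [← Category.comp_id (inv (b' ≫ b) ≫ b'), ← hr, ← Category.assoc _ b, hl,
        Category.id_comp]
    exact ⟨b' ≫ inv (b ≫ b'), hr, by rw [← heq, hl]⟩
  refine ⟨_, hδ'.trans (seqClass_eq_of_iso (asIso b) ?_ ?_).symm⟩
  · simp [hb₁]
  · simpa using hb₂

end Exactness

theorem Conflation.of_iso_left {A A' B X : C} {x : A ⟶ B} {y : B ⟶ X} (h : T.Conflation x y)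
    (a : A ≅ A') : T.Conflation (a.inv ≫ x) y := by
  simpa using h.of_iso_ends a (Iso.refl X)

theorem Conflation.of_iso_right {A B X X' : C} {x : A ⟶ B} {y : B ⟶ X} (h : T.Conflation x y)
    (c : X ≅ X') : T.Conflation x (y ≫ c.hom) := by
  simpa using h.of_iso_ends (Iso.refl A) c

/-! ### Pushouts, pullbacks, composition and splitting of conflations -/

/-- The pushout of two inflations with the same source. -/
theorem Conflation.exists_pushout {A B X B' X' : C} {x : A ⟶ B} {y : B ⟶ X} {x' : A ⟶ B'}
    {y' : B' ⟶ X'} (h : T.Conflation x y) (h' : T.Conflation x' y') :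
    ∃ (Z : C) (i : B' ⟶ Z) (p : Z ⟶ X) (i' : B ⟶ Z) (p' : Z ⟶ X'),
      T.Conflation i p ∧ T.Conflation i' p' := by
  obtain ⟨δ, hδ⟩ := h
  obtain ⟨δ', hδ'⟩ := h'
  -- This class on `X ⊞ X'` restricts to `δ` and `δ'` along the inclusions, so (ET4)ᵒᵖ with either
  -- projection recovers `B` or `B'` as the first term.
  obtain ⟨Z, f', f, hθ⟩ := T.exists_realization
    (pull T.E (biprod.fst : X ⊞ X' ⟶ X) δ + pull T.E (biprod.snd : X ⊞ X' ⟶ X') δ')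
  obtain ⟨N, d, e, k, ε, -, -, hε, hN, -, -⟩ :=
    T.et4_op _ 0 f' f _ _ hθ (T.s_zero_swap X X')
  obtain ⟨N', d', e', k', ε', -, -, hε', hN', -, -⟩ :=
    T.et4_op _ 0 f' f _ _ hθ (T.s_zero X' X)
  simp only [pull_map_add, pull_pull, biprod.inl_fst, biprod.inl_snd, biprod.inr_fst,
    biprod.inr_snd, pull_id, pull_zero, add_zero, zero_add] at hN hN'
  obtain ⟨b, -, -⟩ := exists_iso_of_seqClass_eq (hN.symm.trans hδ')
  obtain ⟨b', -, -⟩ := exists_iso_of_seqClass_eq (hN'.symm.trans hδ)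
  exact ⟨Z, _, _, _, _, Conflation.of_iso_left ⟨ε, hε⟩ b, Conflation.of_iso_left ⟨ε', hε'⟩ b'⟩

/-- The pullback of two deflations with the same target. -/
theorem Conflation.exists_pullback {A B X A' B' : C} {x : A ⟶ B} {y : B ⟶ X} {x' : A' ⟶ B'}
    {y' : B' ⟶ X} (h : T.Conflation x y) (h' : T.Conflation x' y') :
    ∃ (Z : C) (i : A ⟶ Z) (p : Z ⟶ B') (i' : A' ⟶ Z) (p' : Z ⟶ B),
      T.Conflation i p ∧ T.Conflation i' p' := by
  obtain ⟨δ, hδ⟩ := h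
  obtain ⟨δ', hδ'⟩ := h'
  obtain ⟨Z, g, g', hθ⟩ := T.exists_realization
    (push T.E (biprod.inl : A ⟶ A ⊞ A') δ + push T.E (biprod.inr : A' ⟶ A ⊞ A') δ')
  obtain ⟨N, k, d, e, ε, -, -, hε, hN, -, -⟩ :=
    T.et4 0 _ _ _ g g' (T.s_zero A' A) hθ
  obtain ⟨N', k', d', e', ε', -, -, hε', hN', -, -⟩ :=
    T.et4 0 _ _ _ g g' (T.s_zero_swap A A') hθ
  simp only [push_map_add, push_push, biprod.inl_fst, biprod.inl_snd, biprod.inr_fst,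
    biprod.inr_snd, push_id, push_zero, add_zero, zero_add] at hN hN'
  obtain ⟨b, -, -⟩ := exists_iso_of_seqClass_eq (hN.symm.trans hδ')
  obtain ⟨b', -, -⟩ := exists_iso_of_seqClass_eq (hN'.symm.trans hδ)
  exact ⟨Z, _, _, _, _, Conflation.of_iso_right ⟨ε, hε⟩ b, Conflation.of_iso_right ⟨ε', hε'⟩ b'⟩

/-- Composition of inflations. -/
theorem Conflation.exists_comp_inflation {A B D M F : C} {f : A ⟶ B} {f' : B ⟶ D} {g : B ⟶ M}
    {g' : M ⟶ F} (h : T.Conflation f f') (h' : T.Conflation g g') :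
    ∃ (N : C) (p : M ⟶ N) (d : D ⟶ N) (e : N ⟶ F),
      T.Conflation (f ≫ g) p ∧ T.Conflation d e := by
  obtain ⟨δ, hδ⟩ := h
  obtain ⟨δ', hδ'⟩ := h'
  obtain ⟨N, p, d, e, ε, -, -, hε, hN, -, -⟩ := T.et4 δ δ' _ _ _ _ hδ hδ'
  exact ⟨N, p, d, e, ⟨_, hε⟩, ⟨_, hN⟩⟩

/-- Composition of deflations. -/
theorem Conflation.exists_comp_deflation {D A B F M : C} {f' : D ⟶ A} {f : A ⟶ B} {g' : F ⟶ B}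
    {g : B ⟶ M} (h : T.Conflation f' f) (h' : T.Conflation g' g) :
    ∃ (N : C) (d : D ⟶ N) (e : N ⟶ F) (i : N ⟶ A),
      T.Conflation i (f ≫ g) ∧ T.Conflation d e := by
  obtain ⟨δ, hδ⟩ := h
  obtain ⟨δ', hδ'⟩ := h'
  obtain ⟨N, d, e, i, ε, -, -, hε, hN, -, -⟩ := T.et4_op δ δ' _ _ _ _ hδ hδ'
  exact ⟨N, d, e, i, ⟨_, hε⟩, ⟨_, hN⟩⟩

variable (T) in
theorem conflation_inl_snd (A X : C) :
    T.Conflation (biprod.inl : A ⟶ A ⊞ X) (biprod.snd : A ⊞ X ⟶ X) :=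
  ⟨0, T.s_zero X A⟩

theorem Conflation.nonempty_iso_biprod {A B X : C} {x : A ⟶ B} {y : B ⟶ X}
    (h : T.Conflation x y) (hz : ∀ δ : Extn T.E X A, δ = 0) : Nonempty (B ≅ A ⊞ X) := by
  obtain ⟨δ, hδ⟩ := h
  rw [hz δ, T.s_zero] at hδ
  obtain ⟨b, -, -⟩ := exists_iso_of_seqClass_eq hδ
  exact ⟨b.symm⟩

theorem Conflation.left_of_split {P : ObjectProperty C} (hP : IsSubcategory P) {A B X : C}
    {x : A ⟶ B} {y : B ⟶ X} (h : T.Conflation x y) (hz : ∀ δ : Extn T.E X A, δ = 0)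
    (hB : P B) : P A := by
  obtain ⟨e⟩ := h.nonempty_iso_biprod hz
  exact hP.summand (hP.iso e hB)

theorem Conflation.right_of_split {P : ObjectProperty C} (hP : IsSubcategory P) {A B X : C}
    {x : A ⟶ B} {y : B ⟶ X} (h : T.Conflation x y) (hz : ∀ δ : Extn T.E X A, δ = 0)
    (hB : P B) : P X := by
  obtain ⟨e⟩ := h.nonempty_iso_biprod hz
  exact hP.summand (hP.iso (e ≪≫ biprod.braiding A X) hB)

theorem IsProjective.extn_eq_zero {P A : C} (hP : T.IsProjective P) (δ : Extn T.E P A) :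
    δ = 0 := by
  obtain ⟨B, x, y, hδ⟩ := T.exists_realization δ
  obtain ⟨b, hb⟩ := hP x y ⟨δ, hδ⟩ (𝟙 P)
  simpa [hb, pull_id] using pull_eq_zero_of_factors hδ b

/-! ### Finite resolutions and dimension shifting -/

theorem resHat_mono {𝒳 𝒴 : ObjectProperty C} (h : 𝒳 ≤ 𝒴) (n : ℕ) :
    T.resHat 𝒳 n ≤ T.resHat 𝒴 n := by
  induction n with
  | zero => exact h
  | succ n ih =>
    rintro M ⟨K, X₀, x, y, hK, hX₀, hc⟩
    exact ⟨K, X₀, x, y, ih _ hK, h _ hX₀, hc⟩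

/-- Dimension shifting. -/
theorem extSucc_eq_zero_of_resHat (hP : T.EnoughProjectives) {𝒴 : ObjectProperty C} {A : C}
    (hA : ∀ (i : ℕ) (Y : C), 𝒴 Y → ∀ δ : T.ExtSucc hP i A Y, δ = 0) (n i : ℕ) (M : C)
    (hM : T.resHat 𝒴 n M) (ξ : T.ExtSucc hP i A M) : ξ = 0 := by
  induction n generalizing i M with
  | zero => exact hA i M hM ξ
  | succ n ih =>
    obtain ⟨K, Y₀, x, y, hK, hY₀, κ, hκ⟩ := hM
    -- Write ξ = f_*ρ with f : Ωⁱ⁺¹A → M. The obstruction to lifting f to `Y₀` lies in 𝔼(Ωⁱ⁺¹A, K),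
    -- zero by induction; then ξ comes from 𝔼(ΩⁱA, Y₀) = 0.
    obtain ⟨P, p, q, hproj, ρ, hρ⟩ := (hP (T.iterSyzygy hP i A)).choose_spec
    obtain ⟨f, rfl⟩ := exists_push_eq_of_isProjective hρ hproj ξ
    obtain ⟨g, rfl⟩ := exists_factor_of_pull_eq_zero hκ f (ih (i + 1) K hK _)
    rw [← push_push, hA i Y₀ hY₀ (push T.E g ρ), push_map_zero]

/-- The objects `Y` with `𝔼(X, Y) = 0` for all `X ∈ 𝒳`. -/
def extPerp (T : ExtriangulatedStructure.{w} C) (𝒳 : ObjectProperty C) : ObjectProperty C :=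
  fun Y => ∀ X : C, 𝒳 X → ∀ δ : Extn T.E X Y, δ = 0

theorem isSubcategory_extPerp (𝒳 : ObjectProperty C) : IsSubcategory (T.extPerp 𝒳) where
  zero Z hZ X _ δ := by
    rw [← push_id T.E δ, hZ.eq_of_src (𝟙 Z) 0, T.push_zero]
  iso e hA X hX δ := by
    rw [← push_id T.E δ, ← e.inv_hom_id, ← push_push, hA X hX (push T.E e.inv δ), push_map_zero]
  sum hA hB X hX δ := by
    rw [← push_id T.E δ, ← biprod.total, T.push_add, ← push_push, ← push_push,
      hA X hX (push T.E biprod.fst δ), hB X hX (push T.E biprod.snd δ), push_map_zero,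
      push_map_zero, add_zero]
  summand {A B} hAB X hX δ := by
    rw [← push_id T.E δ, ← biprod.inl_fst (X := A) (Y := B), ← push_push,
      hAB X hX (push T.E biprod.inl δ), push_map_zero]

theorem isSubcategory_top : IsSubcategory (⊤ : ObjectProperty C) :=
  ⟨fun _ _ => trivial, fun _ _ => trivial, fun _ _ => trivial, fun _ => trivial⟩

/-- Pulling back X₀ → X to B replaces `X₀` by an extension of it by `A`, with the same kernel `L`.
-/
theorem resHat_middle_of_conflation {𝒳 : ObjectProperty C} (hext : T.ClosedUnderExtensions 𝒳)
    {n : ℕ} {A B X : C} {x : A ⟶ B} {y : B ⟶ X} (h : T.Conflation x y) (hA : 𝒳 A)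
    (hX : T.resHat 𝒳 n X) : T.resHat 𝒳 n B := by
  cases n with
  | zero => exact hext x y h hA hX
  | succ n =>
    obtain ⟨L, X₀, l, p, hL, hX₀, hc⟩ := hX
    obtain ⟨Z, i, q, i', q', h₁, h₂⟩ := h.exists_pullback hc
    exact ⟨L, Z, i', q', hL, hext _ _ h₁ hA hX₀, h₂⟩

/-- The cocone `N` of the composite X₀ → B → X lies in 𝒳 and covers `A` with the old kernel `K`. -/
theorem resHat_of_conflation_of_resHat {𝒳 : ObjectProperty C}
    (hcoc : T.ClosedUnderCoconesOfDeflations 𝒳)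
    {n : ℕ} {A B X : C} {x : A ⟶ B} {y : B ⟶ X} (h : T.Conflation x y) (hB : T.resHat 𝒳 n B)
    (hX : 𝒳 X) : T.resHat 𝒳 n A := by
  cases n with
  | zero => exact hcoc x y h hB hX
  | succ n =>
    obtain ⟨K, X₀, k, p, hK, hX₀, hc⟩ := hB
    obtain ⟨N, d, e, i, h₁, h₂⟩ := hc.exists_comp_deflation h
    exact ⟨K, N, d, e, hK, hcoc _ _ h₁ hX₀ hX, h₂⟩

/-! ### Approximations for left Frobenius pairs -/

namespace IsLeftFrobeniusPair

variable {hP : T.EnoughProjectives} {𝒳 𝒲 : ObjectProperty C}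

theorem resHat_le_extPerp (h : T.IsLeftFrobeniusPair hP 𝒳 𝒲) (n : ℕ) :
    T.resHat 𝒲 n ≤ T.extPerp 𝒳 := fun M hM X hX δ =>
  extSucc_eq_zero_of_resHat hP (fun i W hW => h.injective W hW i X hX) n 0 M hM δ

/-- Auslander–Buchweitz approximations. -/
theorem exists_approximations (h : T.IsLeftFrobeniusPair hP 𝒳 𝒲) (n : ℕ) (M : C)
    (hM : T.resHat 𝒳 n M) :
    (∃ k, T.Cone (T.resHat 𝒲 k) 𝒳 M) ∧ ∃ k, T.CoCone (T.resHat 𝒲 k) 𝒳 M := by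
  have hcocone : ∀ M : C, (∃ k, T.Cone (T.resHat 𝒲 k) 𝒳 M) →
      ∃ k, T.CoCone (T.resHat 𝒲 k) 𝒳 M := by
    rintro M ⟨k, V, U, x, y, hV, hU, hc⟩
    -- Embedding `U` in `W` makes the cone `N` of V → W a target for M; its resolution is one step
    -- longer.
    obtain ⟨W, X', i, p, hW, hX', hc'⟩ := h.cogenerator.2 U hU
    obtain ⟨N, q, d, e, h₁, h₂⟩ := hc.exists_comp_inflation hc'
    exact ⟨k + 1, N, X', d, e, ⟨V, W, _, q, hV, hW, h₁⟩, hX', h₂⟩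
  suffices hcone : ∃ k, T.Cone (T.resHat 𝒲 k) 𝒳 M from ⟨hcone, hcocone M hcone⟩
  induction n generalizing M with
  | zero =>
    have hX : 𝒳 (0 ⊞ M) :=
      h.subcategory_left.sum (h.subcategory_left.zero _ (isZero_zero C)) hM
    exact ⟨0, 0, 0 ⊞ M, _, _, h.subcategory_right.zero _ (isZero_zero C), hX,
      T.conflation_inl_snd 0 M⟩
  | succ n ih =>
    obtain ⟨K, X₀, x, y, hK, hX₀, hc⟩ := hM
    obtain ⟨k, V, U, i, p, hV, hU, hc'⟩ := hcocone K (ih K hK)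
    -- The pushout `Z` of `X₀` and `V` under `K` is an extension of `U` by `X₀`.
    obtain ⟨Z, j, q, j', q', h₁, h₂⟩ := hc.exists_pushout hc'
    exact ⟨k, V, Z, j, q, hV, h.extensions _ _ h₂ hX₀ hU, h₁⟩

end IsLeftFrobeniusPair

/-! ### Strong pairs: the perpendicular class and the model structure -/

namespace IsStrongLeftFrobeniusPair

variable {hP : T.EnoughProjectives} {𝒳 𝒲 : ObjectProperty C}

theorem extVanish_of_resHat_eq_top (h : T.IsStrongLeftFrobeniusPair hP 𝒳 𝒲) {n : ℕ}
    (hn : T.resHat 𝒳 n = ⊤) : T.ExtVanish 𝒲 ⊤ := fun W M hW _ δ =>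
  extSucc_eq_zero_of_resHat hP (h.projective W hW) n 0 M (by rw [hn]; trivial) δ

/-- If the objects of `𝒲` have no extensions, a cocone of a deflation from `𝒲` onto an object of
`𝒳^⊥` is again in `𝒳^⊥`. -/
theorem extPerp_of_conflation (h : T.IsStrongLeftFrobeniusPair hP 𝒳 𝒲)
    (hW : T.ExtVanish 𝒲 ⊤) {N W M : C} {x : N ⟶ W} {y : W ⟶ M} (hc : T.Conflation x y)
    (hW' : 𝒲 W) (hM : T.extPerp 𝒳 M) : T.extPerp 𝒳 N := by
  intro X hX ξ
  obtain ⟨ν, hν⟩ := hc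
  -- Since 𝔼(X, W) = 0, ξ = f^*ν with f : X → M. As 𝔼(X₁, M) = 0, f extends to `W₁`, so ξ comes from
  -- 𝔼(W₁, N) = 0.
  obtain ⟨f, rfl⟩ := exists_pull_eq_of_push_eq_zero hν ξ (h.injective W hW' 0 X hX _)
  obtain ⟨W₁, X₁, i, p, hW₁, hX₁, σ, hσ⟩ := h.cogenerator.2 X hX
  obtain ⟨g, rfl⟩ := exists_extension_of_push_eq_zero hσ f (hM X₁ hX₁ _)
  rw [← pull_pull, hW W₁ N hW₁ trivial (pull T.E g ν), pull_map_zero]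

theorem resHat_of_extPerp (h : T.IsStrongLeftFrobeniusPair hP 𝒳 𝒲)
    (hW : T.ExtVanish 𝒲 ⊤) (n : ℕ) (M : C) (hM : T.resHat 𝒳 n M) (hM' : T.extPerp 𝒳 M) :
    T.resHat 𝒲 n M := by
  induction n generalizing M with
  | zero =>
    obtain ⟨W, X', x, y, hW', hX', hc⟩ := h.cogenerator.2 M hM
    exact hc.left_of_split h.subcategory_right (hM' X' hX') hW'
  | succ n ih =>
    obtain ⟨K, X₀, x, y, hK, hX₀, hc⟩ := hM
    -- Covering `X₀` by `W` changes the kernel to an extension of `K` by `X'`, which stays in 𝒳̂ₙ.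
    obtain ⟨X', W, i, p, hW', hX', hc'⟩ := h.generator.2 X₀ hX₀
    obtain ⟨N, d, e, j, h₁, h₂⟩ := hc'.exists_comp_deflation hc
    exact ⟨N, W, j, _, ih N (resHat_middle_of_conflation h.extensions h₂ hX' hK)
      (h.extPerp_of_conflation hW h₁ hW' hM'), hW', h₁⟩

theorem resHat_eq_extPerp (h : T.IsStrongLeftFrobeniusPair hP 𝒳 𝒲) {n : ℕ}
    (hn : T.resHat 𝒳 n = ⊤) : T.resHat 𝒲 n = T.extPerp 𝒳 :=
  le_antisymm (h.resHat_le_extPerp n) fun M hM =>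
    h.resHat_of_extPerp (h.extVanish_of_resHat_eq_top hn) n M (by rw [hn]; trivial) hM

/-- Deflations onto `P` split, so `P` is a summand first of an object of 𝒳, then of one of 𝒲. -/
theorem mem_of_isProjective (h : T.IsStrongLeftFrobeniusPair hP 𝒳 𝒲) {n : ℕ}
    {P : C} (hproj : T.IsProjective P) (hn : T.resHat 𝒳 n P) : 𝒲 P := by
  have hX : 𝒳 P := by
    cases n with
    | zero => exact hn
    | succ n =>
      obtain ⟨K, X₀, x, y, -, hX₀, hc⟩ := hn
      exact hc.right_of_split h.subcategory_left hproj.extn_eq_zero hX₀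
  obtain ⟨X', W, x, y, hW, -, hc⟩ := h.generator.2 P hX
  exact hc.right_of_split h.subcategory_right hproj.extn_eq_zero hW

theorem isCotorsionPair_top (h : T.IsStrongLeftFrobeniusPair hP 𝒳 𝒲) {n : ℕ}
    (hn : T.resHat 𝒳 n = ⊤) : T.IsCotorsionPair 𝒲 ⊤ where
  subcategory_left := h.subcategory_right
  subcategory_right := isSubcategory_top
  vanish := h.extVanish_of_resHat_eq_top hn
  cone M := by
    obtain ⟨A, P, x, y, hproj, hc⟩ := hP M
    exact ⟨A, P, x, y, trivial, h.mem_of_isProjective hproj (n := n) (by rw [hn]; trivial), hc⟩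
  cocone M := ⟨M ⊞ 0, 0, _, _, trivial, h.subcategory_right.zero _ (isZero_zero C),
    T.conflation_inl_snd M 0⟩

theorem isCotorsionPair_resHat (h : T.IsStrongLeftFrobeniusPair hP 𝒳 𝒲) {n : ℕ}
    (hn : T.resHat 𝒳 n = ⊤) : T.IsCotorsionPair 𝒳 (T.resHat 𝒲 n) := by
  have happ (M : C) := h.exists_approximations n M (by rw [hn]; trivial)
  rw [h.resHat_eq_extPerp hn]
  exact
    { subcategory_left := h.subcategory_left
      subcategory_right := isSubcategory_extPerp 𝒳
      vanish := fun U V hU hV => hV U hU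
      cone := fun M => by
        obtain ⟨k, V, U, x, y, hV, hU, hc⟩ := (happ M).1
        exact ⟨V, U, x, y, h.resHat_le_extPerp k V hV, hU, hc⟩
      cocone := fun M => by
        obtain ⟨k, V, U, x, y, hV, hU, hc⟩ := (happ M).2
        exact ⟨V, U, x, y, h.resHat_le_extPerp k V hV, hU, hc⟩ }

theorem cone_eq_coCone (h : T.IsStrongLeftFrobeniusPair hP 𝒳 𝒲) {n : ℕ}
    (hn : T.resHat 𝒳 n = ⊤) :
    T.Cone (T.resHat 𝒲 n) 𝒲 = T.CoCone (T.resHat 𝒲 n) 𝒲 := by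
  have hperp := h.resHat_eq_extPerp hn
  apply le_antisymm
  · rintro M ⟨V, W, x, y, hV, hW, hc⟩
    -- Length `n + 1` is harmless: every 𝒲̂ₖ lies in the perpendicular class, which is 𝒲̂ₙ.
    have hM : T.extPerp 𝒳 M :=
      h.resHat_le_extPerp (n + 1) M ⟨V, W, x, y, hV, hW, hc⟩
    refine ⟨M ⊞ 0, 0, _, _, ?_, h.subcategory_right.zero _ (isZero_zero C),
      T.conflation_inl_snd M 0⟩
    rw [hperp]
    exact (isSubcategory_extPerp 𝒳).sum hM ((isSubcategory_extPerp 𝒳).zero _ (isZero_zero C))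
  · rintro M ⟨V, W, x, y, hV, hW, hc⟩
    rw [hperp] at hV
    -- 𝔼(W, M) = 0 splits the conflation, so `M` is a summand of `V`.
    have hM : T.extPerp 𝒳 M := hc.left_of_split (isSubcategory_extPerp 𝒳)
      (h.extVanish_of_resHat_eq_top hn W M hW trivial) hV
    obtain ⟨A, P, x, y, hproj, hc⟩ := hP M
    have hPW : 𝒲 P := h.mem_of_isProjective hproj (n := n) (by rw [hn]; trivial)
    refine ⟨A, P, x, y, ?_, hPW, hc⟩
    rw [hperp]
    exact h.extPerp_of_conflation (h.extVanish_of_resHat_eq_top hn) hc hPW hM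

end IsStrongLeftFrobeniusPair

end ExtriangulatedStructure

end Extri

theorem theorem4p4 {C : Type u} [Category.{v} C] [Preadditive C] [HasZeroObject C]
    [HasBinaryBiproducts C] (T : Extri.ExtriangulatedStructure.{w} C)
    (hP : T.EnoughProjectives) (hI : T.EnoughInjectives)
    (𝒳 𝒲 : ObjectProperty C) (h : T.IsStrongLeftFrobeniusPair hP 𝒳 𝒲) (n : ℕ) :
    T.resHat 𝒳 n = ⊤ ↔ T.IsHoveyTwinCotorsionPair 𝒲 ⊤ 𝒳 (T.resHat 𝒲 n) := by
  constructor
  · intro hn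
    exact
      { left := h.isCotorsionPair_top hn
        right := h.isCotorsionPair_resHat hn
        vanish := fun W V hW _ => h.extVanish_of_resHat_eq_top hn W V hW trivial
        hovey := h.cone_eq_coCone hn }
  · intro hH
    refine top_le_iff.mp fun M _ => ?_
    obtain ⟨V, U, x, y, hV, hU, hc⟩ := hH.right.cocone M
    exact Extri.ExtriangulatedStructure.resHat_of_conflation_of_resHat h.cocones hc
      (Extri.ExtriangulatedStructure.resHat_mono h.cogenerator.1 n V hV) hU
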